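/- **Example (a POVM class that is not learnable).** Let $H$ be a complex Hilbert space, $\{\rho_j\}_{j=1}^\infty$ an orthonormal sequence in $H$, $\gamma>0$, and $\beta_j\in(1/2+\gamma,1)$ for every $j$. Let $\mathcal X$ be any set of states (density operators, i.e. positive operators of trace one) on $H$ that contains all the pure states $x_j=|\rho_j\rangle\langle\rho_j|$. For $b\in\{0,1\}^{\mathbb N}$ let $\Pi^{(b)}=(\Pi^{(b)}_0,\,I-\Pi^{(b)}_0)$ be the two-outcome POVM with $$\Pi^{(b)}_0=\sum_{j=1}^\infty \beta_j^{1-b_j}(1-\beta_j)^{b_j}\,|\rho_j\rangle\langle\rho_j|$$ (strong operator convergence), and let $\mathrm{Hyp}=\{\Pi^{(b)} : b\in\{0,1\}^{\mathbb N}\}$. Write $h[x]$ for the random outcome of measuring the state $x$ with the POVM $h$, so that $\mathrm P[h[x]=y]=\mathrm{Tr}(x\,h_y)$. Then: 1. $\mathrm P[\Pi^{(b)}[x_j]=b_j]=\beta_j$ for all $b$ and $j$. 2. The states $x_1,x_2,\dots$ are pairwise distinct, and the infinite set they form is $\gamma$-fat-shattered by $\mathrm{Hyp}$ with witness numbers $r_j=1/2$: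 for every $b\in\{0,1\}^{\mathbb N}$ there is $h\in\mathrm{Hyp}$ such that, for all $j$, $\mathrm P[h[x_j]=1]\le 1/2-\gamma$ if $b_j=0$ and $\mathrm P[h[x_j]=1]\ge 1/2+\gamma$ if $b_j=1$. In particular the $\gamma$-fat-shattering dimension of $\mathrm{Hyp}$ on $\mathcal X$ (the largest length of a finite dataset in $\mathcal X$ that is $\gamma$-fat-shattered in this sense, for some witness numbers) is infinite. 3. $\mathrm{Hyp}$ is not PAC learnable on $\mathcal X$ for the misclassification loss. Here, with $R_D(h)=\mathrm P_{(X,Y)\sim D}[h[X]\ne Y]$, PAC learnable means: for all $\epsilon,\delta>0$ there are a sample size $m$ and a learning rule such that for every probability distribution $D$ on $\mathcal X\times\{0,1\}$ and a sample $((X_k,Y_k))_{k=1}^m\sim D^m$, the rule outputs, with probability at least $1-\delta$, some $h\in\mathrm{Hyp}$ with $R_D(h)\le\inf_{h'\in\mathrm{Hyp}}R_D(h')+\epsilon$. A learning rule sees the labels $Y_k$, and has access to the states only by measuring a register prepared in $X_1\otimes\dots\otimes X_m$: at each time $t=0,1,2,\dots$ it performs on $H^{\otimes m}$ a POVM with finitely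 many outcomes, chosen from the labels, the previous outcomes and private randomness, the state $Z$ becoming $\sqrt E Z\sqrt E/\mathrm{Tr}(ZE)$ when the outcome with effect $E$ is observed; its output is a function of the labels, the sequence of outcomes and the private randomness. -/

import Mathlib

open MeasureTheory ProbabilityTheory InnerProductSpace
open scoped ENNReal

namespace POVMLearning

noncomputable section

set_option linter.unusedSectionVars false

section Trace

variable {H : Type*} [NormedAddCommGroup H] [InnerProductSpace ℂ H] [CompleteSpace H]

theorem hasSum_norm_sq {ι : Type*} (b : HilbertBasis ι ℂ H) (x : H) :
    HasSum (fun i => ‖inner ℂ (b i) x‖ ^ 2) (‖x‖ ^ 2) := by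
  have h := Complex.hasSum_re (b.hasSum_inner_mul_inner x x)
  convert h using 1
  · ext i
    rw [← inner_conj_symm x, Complex.conj_mul']
    norm_cast
  · rw [inner_self_eq_norm_sq_to_K]; norm_cast

theorem hasSum_hilbertSchmidt {ι : Type*} (b : HilbertBasis ι ℂ H) {C D : H →L[ℂ] H}
    (hC : Summable fun i => ‖C (b i)‖ ^ 2) (hD : Summable fun i => ‖D (b i)‖ ^ 2) :
    Summable (fun i => inner ℂ (C (b i)) (D (b i))) ∧
    HasSum (fun j => inner ℂ (ContinuousLinearMap.adjoint D (b j))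
        (ContinuousLinearMap.adjoint C (b j)))
      (∑' i, inner ℂ (C (b i)) (D (b i))) := by
  let f : ι × ι → ℂ := fun p => inner ℂ (C (b p.1)) (b p.2) * inner ℂ (b p.2) (D (b p.1))
  have key : ∀ {C : H →L[ℂ] H}, (Summable fun i => ‖C (b i)‖ ^ 2) →
      Summable fun p : ι × ι => ‖inner ℂ (b p.2) (C (b p.1))‖ ^ 2 := by
    intro C hC
    refine (summable_prod_of_nonneg fun p => by positivity).2
      ⟨fun i => (hasSum_norm_sq b (C (b i))).summable, ?_⟩
    simpa only [(hasSum_norm_sq b (C (b _))).tsum_eq] using hC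
  have hf : Summable f := by
    refine Summable.of_norm_bounded (((key hC).add (key hD)).div_const 2) fun p => ?_
    simp only [f, norm_mul]
    rw [norm_inner_symm]
    nlinarith [sq_nonneg (‖inner ℂ (b p.2) (C (b p.1))‖ - ‖inner ℂ (b p.2) (D (b p.1))‖)]
  have hrow : ∀ i, ∑' j, f (i, j) = inner ℂ (C (b i)) (D (b i)) := fun i =>
    b.tsum_inner_mul_inner (C (b i)) (D (b i))
  have hcol : ∀ j, ∑' i, f (i, j) = inner ℂ (ContinuousLinearMap.adjoint D (b j))
      (ContinuousLinearMap.adjoint C (b j)) := by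
    intro j
    rw [← b.tsum_inner_mul_inner]
    refine tsum_congr fun i => ?_
    simp only [f, ContinuousLinearMap.adjoint_inner_left, ContinuousLinearMap.adjoint_inner_right]
    ring
  refine ⟨?_, ?_⟩
  · simpa only [hrow] using hf.prod
  · have h1 : ∑' i, inner ℂ (C (b i)) (D (b i)) = ∑' p, f p := by
      rw [hf.tsum_prod]; simp only [hrow]
    have h2 : Summable fun p : ι × ι => f p.swap := hf.prod_symm
    have h3 := h2.prod
    have h4 : ∑' p : ι × ι, f p.swap = ∑' p, f p := (Equiv.prodComm ι ι).tsum_eq f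
    rw [h1, ← h4, h2.tsum_prod]
    simp only [Prod.swap, hcol] at h3 ⊢
    exact h3.hasSum

variable (H) in
/-- The index set of a fixed Hilbert basis of `H`. -/
def basisSet : Set H := (exists_hilbertBasis ℂ H).choose

variable (H) in
/-- A fixed Hilbert basis of `H`. -/
def basis : HilbertBasis (basisSet H) ℂ H := (exists_hilbertBasis ℂ H).choose_spec.choose

/-- The trace `∑ᵢ ⟨eᵢ, A eᵢ⟩`. The sum is `0` if it does not converge absolutely; it is used below
for operators `Z` and `Z E` with `Z` positive of trace one and `E` bounded, and there it converges
and does not depend on the basis. -/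
def trace (A : H →L[ℂ] H) : ℂ := ∑' i, inner ℂ (basis H i) (A (basis H i))

variable (H) in
/-- A state (density operator): a positive operator of trace one. -/
structure DensityOperator where
  op : H →L[ℂ] H
  isPositive : op.IsPositive
  trace_eq_one : trace op = 1

/-- A POVM with outcomes in the finite type `Y`. -/
structure POVM (K Y : Type*) [NormedAddCommGroup K] [InnerProductSpace ℂ K] [Fintype Y] where
  effect : Y → K →L[ℂ] K
  isPositive : ∀ y, (effect y).IsPositive
  sum_eq_one : ∑ y, effect y = 1

/-- The positive square root. -/
def opSqrt (A : H →L[ℂ] H) : H →L[ℂ] H := CFC.sqrt A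

theorem opSqrt_isPositive (A : H →L[ℂ] H) : (opSqrt A).IsPositive :=
  (ContinuousLinearMap.nonneg_iff_isPositive _).1 (CFC.sqrt_nonneg A)

theorem opSqrt_sq {A : H →L[ℂ] H} (hA : A.IsPositive) (x : H) : opSqrt A (opSqrt A x) = A x := by
  have := CFC.sqrt_mul_sqrt_self A ((ContinuousLinearMap.nonneg_iff_isPositive _).2 hA)
  exact congrArg (fun T : H →L[ℂ] H => T x) this

theorem inner_opSqrt (A : H →L[ℂ] H) (x y : H) :
    inner ℂ (opSqrt A x) y = inner ℂ x (opSqrt A y) :=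
  (opSqrt_isPositive A).inner_left_eq_inner_right x y

theorem inner_eq_norm_opSqrt {A : H →L[ℂ] H} (hA : A.IsPositive) (x : H) :
    inner ℂ x (A x) = ((‖opSqrt A x‖ ^ 2 : ℝ) : ℂ) := by
  rw [← opSqrt_sq hA, ← inner_opSqrt, inner_self_eq_norm_sq_to_K]; norm_cast

theorem DensityOperator.hasSum (Z : DensityOperator H) :
    HasSum (fun i => ‖opSqrt Z.op (basis H i)‖ ^ 2) 1 := by
  have h := Z.trace_eq_one
  have hs : Summable fun i => inner ℂ (basis H i) (Z.op (basis H i)) := by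
    by_contra hs
    rw [trace, tsum_eq_zero_of_not_summable hs] at h
    exact zero_ne_one h
  have h' := hs.hasSum
  rw [← trace, h] at h'
  simp only [inner_eq_norm_opSqrt Z.isPositive] at h'
  exact_mod_cast Complex.hasSum_re h'

theorem hasSum_born (Z : DensityOperator H) {E : H →L[ℂ] H} (hE : E.IsPositive) :
    HasSum (fun i => ‖opSqrt E (opSqrt Z.op (basis H i))‖ ^ 2) (trace (Z.op ∘L E)).re ∧
    Summable (fun i => inner ℂ (basis H i) (Z.op (E (basis H i)))) ∧
    HasSum (fun i => ‖opSqrt Z.op (opSqrt E (basis H i))‖ ^ 2) (trace (Z.op ∘L E)).re := by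
  set A := opSqrt Z.op with hA
  have hAadj : ContinuousLinearMap.adjoint A = A := (opSqrt_isPositive _).isSelfAdjoint.adjoint_eq
  have hEadj : ContinuousLinearMap.adjoint E = E := hE.isSelfAdjoint.adjoint_eq
  have hMadj : ContinuousLinearMap.adjoint (opSqrt E) = opSqrt E :=
    (opSqrt_isPositive _).isSelfAdjoint.adjoint_eq
  have hC : Summable fun i => ‖A (basis H i)‖ ^ 2 := Z.hasSum.summable
  have left : ∀ B : H →L[ℂ] H, Summable fun i => ‖(B ∘L A) (basis H i)‖ ^ 2 := fun B => by
    refine Summable.of_nonneg_of_le (fun _ => by positivity) (fun i => ?_) (hC.mul_left (‖B‖ ^ 2))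
    rw [← mul_pow]
    gcongr
    exact B.le_opNorm _
  have swap : ∀ B : H →L[ℂ] H, (Summable fun i => ‖B (basis H i)‖ ^ 2) →
      HasSum (fun i => ‖ContinuousLinearMap.adjoint B (basis H i)‖ ^ 2)
        (∑' i, ‖B (basis H i)‖ ^ 2) := by
    intro B hB
    have := (hasSum_hilbertSchmidt (basis H) hB hB).2
    simp only [inner_self_eq_norm_sq_to_K] at this
    have := Complex.hasSum_re this
    norm_cast at this
  have hD : Summable fun i => ‖(A ∘L E) (basis H i)‖ ^ 2 := by
    have := (swap (E ∘L A) (left E)).summable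
    simpa only [ContinuousLinearMap.adjoint_comp, hAadj, hEadj] using this
  have h := hasSum_hilbertSchmidt (basis H) hC hD
  have e1 : ∀ i, inner ℂ (A (basis H i)) ((A ∘L E) (basis H i)) =
      inner ℂ (basis H i) (Z.op (E (basis H i))) := fun i => by
    rw [hA, inner_opSqrt, ContinuousLinearMap.comp_apply, opSqrt_sq Z.isPositive]
  have e2 : ∀ j, inner ℂ (ContinuousLinearMap.adjoint (A ∘L E) (basis H j))
      (ContinuousLinearMap.adjoint A (basis H j)) =
      ((‖opSqrt E (A (basis H j))‖ ^ 2 : ℝ) : ℂ) := fun j => by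
    rw [ContinuousLinearMap.adjoint_comp, hAadj, hEadj, ContinuousLinearMap.comp_apply,
      hE.inner_left_eq_inner_right, inner_eq_norm_opSqrt hE]
  simp only [e1, e2] at h
  have h1 : HasSum (fun i => ‖opSqrt E (A (basis H i))‖ ^ 2) (trace (Z.op ∘L E)).re := by
    exact_mod_cast Complex.hasSum_re h.2
  refine ⟨h1, h.1, ?_⟩
  have h2 := swap (opSqrt E ∘L A) (left _)
  rw [ContinuousLinearMap.adjoint_comp, hAadj, hMadj] at h2
  simp only [ContinuousLinearMap.comp_apply] at h2
  rwa [h1.tsum_eq] at h2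

end Trace

section Diagonal

variable {H : Type*} [NormedAddCommGroup H] [InnerProductSpace ℂ H] [CompleteSpace H]

/-- The pure state `|v⟩⟨v|` of a unit vector `v`. -/
def pureState (v : H) (hv : ‖v‖ = 1) : DensityOperator H where
  op := rankOne ℂ v v
  isPositive := isPositive_rankOne_self v
  trace_eq_one := by
    have h := (basis H).tsum_inner_mul_inner v v
    rw [inner_self_eq_norm_sq_to_K, hv] at h
    rw [trace]
    simp only [rankOne_apply, inner_smul_right]
    simpa using h

theorem hasSum_diagonal {ρ : ℕ → H} (hρ : Orthonormal ℂ ρ) {c : ℕ → ℝ}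
    (hc : ∀ j, c j ∈ Set.Icc (0 : ℝ) 1) (v : H) :
    Summable (fun j => (c j : ℂ) • rankOne ℂ (ρ j) (ρ j) v) ∧
      HasSum (fun j => c j * ‖inner ℂ (ρ j) v‖ ^ 2)
        (inner ℂ v (∑' j, (c j : ℂ) • rankOne ℂ (ρ j) (ρ j) v)).re := by
  have h0 : Summable fun j => (c j : ℂ) • rankOne ℂ (ρ j) (ρ j) v := by
    have := (hρ.orthogonalFamily.summable_iff_norm_sq_summable
      (fun j => (c j : ℂ) * inner ℂ (ρ j) v)).2 ?_
    · simpa [rankOne_apply, smul_smul] using this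
    · refine Summable.of_nonneg_of_le (fun _ => by positivity) (fun j => ?_)
        (hρ.inner_products_summable v)
      rw [norm_mul, mul_pow, Complex.norm_real, Real.norm_of_nonneg (hc j).1]
      exact mul_le_of_le_one_left (by positivity) (pow_le_one₀ (hc j).1 (hc j).2)
  refine ⟨h0, ?_⟩
  have h1 := Complex.hasSum_re (h0.hasSum.mapL (innerSL ℂ v))
  simp only [innerSL_apply_apply] at h1
  convert h1 using 1
  ext j
  rw [rankOne_apply, inner_smul_right, inner_smul_right, ← inner_conj_symm v, Complex.mul_conj']
  norm_cast

theorem norm_diagonal_le {ρ : ℕ → H} (hρ : Orthonormal ℂ ρ) {c : ℕ → ℝ}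
    (hc : ∀ j, c j ∈ Set.Icc (0 : ℝ) 1) (v : H) :
    ‖∑' j, (c j : ℂ) • rankOne ℂ (ρ j) (ρ j) v‖ ≤ 1 * ‖v‖ := by
  set w := ∑' j, (c j : ℂ) • rankOne ℂ (ρ j) (ρ j) v with hw
  have h1 := (hasSum_diagonal hρ hc v).1.hasSum.mapL (innerSL ℂ w)
  simp only [innerSL_apply_apply, ← hw] at h1
  have hin : ∀ j, inner ℂ (ρ j) w = (c j : ℂ) * inner ℂ (ρ j) v := by
    intro j
    have h2 := (hasSum_diagonal hρ hc v).1.hasSum.mapL (innerSL ℂ (ρ j))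
    simp only [innerSL_apply_apply, ← hw] at h2
    refine h2.unique ?_
    convert hasSum_single j (fun i hi => ?_) using 1
    · rw [rankOne_apply, inner_smul_right, inner_smul_right, inner_self_eq_norm_sq_to_K, hρ.1 j]
      simp
    · rw [rankOne_apply, inner_smul_right, inner_smul_right, hρ.2 hi.symm]
      simp
  have h3 := Complex.hasSum_re h1
  rw [inner_self_eq_norm_sq_to_K] at h3
  have h4 : ∀ j, (inner ℂ w ((c j : ℂ) • rankOne ℂ (ρ j) (ρ j) v)).re =
      (c j * ‖inner ℂ (ρ j) v‖) ^ 2 := by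
    intro j
    rw [rankOne_apply, inner_smul_right, inner_smul_right, ← inner_conj_symm w, hin, map_mul,
      Complex.conj_ofReal, mul_left_comm (inner ℂ (ρ j) v), Complex.mul_conj', ← mul_assoc]
    norm_cast
    ring
  simp only [h4] at h3
  have h5 : ‖w‖ ^ 2 ≤ ‖v‖ ^ 2 := by
    have h6 : HasSum (fun j => (c j * ‖inner ℂ (ρ j) v‖) ^ 2) (‖w‖ ^ 2) := by exact_mod_cast h3
    rw [← h6.tsum_eq]
    refine (h6.summable.tsum_le_tsum (fun j => ?_) (hρ.inner_products_summable v)).trans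
      (hρ.tsum_inner_products_le v)
    rw [mul_pow]
    exact mul_le_of_le_one_left (by positivity) (pow_le_one₀ (hc j).1 (hc j).2)
  rw [one_mul]
  exact abs_le_of_sq_le_sq' h5 (norm_nonneg _) |>.2

/-- The operator `∑ⱼ cⱼ |ρⱼ⟩⟨ρⱼ|`; the series converges in the strong operator topology. -/
def diagonalOp {ρ : ℕ → H} (hρ : Orthonormal ℂ ρ) (c : ℕ → ℝ)
    (hc : ∀ j, c j ∈ Set.Icc (0 : ℝ) 1) : H →L[ℂ] H :=
  LinearMap.mkContinuous
    { toFun := fun v => ∑' j, (c j : ℂ) • rankOne ℂ (ρ j) (ρ j) v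
      map_add' := fun v w => by
        rw [← (hasSum_diagonal hρ hc v).1.tsum_add (hasSum_diagonal hρ hc w).1]
        simp only [map_add, smul_add]
      map_smul' := fun a v => by
        rw [RingHom.id_apply, ← (hasSum_diagonal hρ hc v).1.tsum_const_smul a]
        simp only [map_smul, smul_comm a] }
    1 (norm_diagonal_le hρ hc)

theorem hasSum_diagonalOp {ρ : ℕ → H} (hρ : Orthonormal ℂ ρ) {c : ℕ → ℝ}
    (hc : ∀ j, c j ∈ Set.Icc (0 : ℝ) 1) (v : H) :
    HasSum (fun j => (c j : ℂ) • rankOne ℂ (ρ j) (ρ j) v) (diagonalOp hρ c hc v) :=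
  (hasSum_diagonal hρ hc v).1.hasSum

theorem diagonalOp_inner {ρ : ℕ → H} (hρ : Orthonormal ℂ ρ) {c : ℕ → ℝ}
    (hc : ∀ j, c j ∈ Set.Icc (0 : ℝ) 1) (v : H) :
    HasSum (fun j => c j * ‖inner ℂ (ρ j) v‖ ^ 2) (inner ℂ v (diagonalOp hρ c hc v)).re ∧
    (inner ℂ v (diagonalOp hρ c hc v)).im = 0 := by
  refine ⟨(hasSum_diagonal hρ hc v).2, ?_⟩
  have h1 := Complex.hasSum_im ((hasSum_diagonalOp hρ hc v).mapL (innerSL ℂ v))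
  simp only [innerSL_apply_apply] at h1
  refine h1.unique ?_
  convert hasSum_zero using 1
  ext j
  rw [rankOne_apply, inner_smul_right, inner_smul_right, ← inner_conj_symm v, Complex.mul_conj']
  norm_cast

theorem isPositive_of_inner {T : H →L[ℂ] H} (h : ∀ v, 0 ≤ (inner ℂ v (T v)).re ∧
    (inner ℂ v (T v)).im = 0) : T.IsPositive := by
  rw [ContinuousLinearMap.isPositive_iff_complex]
  intro v
  have e : inner ℂ (T v) v = (((inner ℂ v (T v)).re : ℝ) : ℂ) := by
    rw [← inner_conj_symm]
    apply Complex.ext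
    · rw [Complex.conj_re, Complex.ofReal_re]
    · rw [Complex.conj_im, (h v).2, Complex.ofReal_im, neg_zero]
  rw [e]
  exact ⟨by simp, (h v).1⟩

/-- The two-outcome POVM with effects `Π₀ = ∑ⱼ cⱼ |ρⱼ⟩⟨ρⱼ|` and `Π₁ = 1 - Π₀`. -/
def diagonalPOVM {ρ : ℕ → H} (hρ : Orthonormal ℂ ρ) (c : ℕ → ℝ)
    (hc : ∀ j, c j ∈ Set.Icc (0 : ℝ) 1) : POVM H (Fin 2) where
  effect := ![diagonalOp hρ c hc, 1 - diagonalOp hρ c hc]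
  isPositive := by
    intro y
    fin_cases y
    · exact isPositive_of_inner fun v => ⟨(diagonalOp_inner hρ hc v).1.nonneg
        fun j => mul_nonneg (hc j).1 (by positivity), (diagonalOp_inner hρ hc v).2⟩
    · refine isPositive_of_inner fun v => ?_
      have h := diagonalOp_inner hρ hc v
      have e : inner ℂ v ((1 - diagonalOp hρ c hc) v) =
          ((‖v‖ ^ 2 : ℝ) : ℂ) - inner ℂ v (diagonalOp hρ c hc v) := by
        rw [sub_apply, one_apply_eq_self, inner_sub_right,
          inner_self_eq_norm_sq_to_K]
        norm_cast
      change 0 ≤ (inner ℂ v ((1 - diagonalOp hρ c hc) v)).re ∧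
        (inner ℂ v ((1 - diagonalOp hρ c hc) v)).im = 0
      rw [e, Complex.sub_re, Complex.sub_im, h.2, Complex.ofReal_re, Complex.ofReal_im]
      refine ⟨?_, by simp⟩
      rw [sub_nonneg, ← h.1.tsum_eq]
      refine (h.1.summable.tsum_le_tsum (fun j => ?_) (hρ.inner_products_summable v)).trans
        (hρ.tsum_inner_products_le v)
      exact mul_le_of_le_one_left (by positivity) (hc j).2
  sum_eq_one := by simp [Fin.sum_univ_two]

end Diagonal

section TensorPower

/-- Product formula for absolutely convergent series over multi-indices. -/
theorem hasSum_prod {κ : Type*} : ∀ (m : ℕ) (f : Fin m → κ → ℂ), (∀ k, Summable fun i => ‖f k i‖) →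
    (Summable fun j : Fin m → κ => ‖∏ k, f k (j k)‖) ∧
      HasSum (fun j : Fin m → κ => ∏ k, f k (j k)) (∏ k, ∑' i, f k i)
  | 0, f, _ => by
    refine ⟨(hasSum_fintype _).summable, ?_⟩
    convert hasSum_fintype (fun j : Fin 0 → κ => ∏ k, f k (j k)) using 1
    simp
  | m + 1, f, hf => by
    obtain ⟨h1, h2⟩ := hasSum_prod m (fun k => f k.succ) fun k => hf k.succ
    have h3 := summable_mul_of_summable_norm (hf 0) h1
    have h4 := summable_norm_iff.2 h3
    have h5 := tsum_mul_tsum_of_summable_norm (hf 0) h1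
    have e : (fun p : κ × (Fin m → κ) => ∏ k, f k ((Fin.consEquiv fun _ => κ) p k)) =
        fun p => f 0 p.1 * ∏ k, f k.succ (p.2 k) := by
      ext p
      rw [Fin.prod_univ_succ]
      simp [Fin.consEquiv]
    constructor
    · rw [← (Fin.consEquiv fun _ => κ).summable_iff]
      have e' : ((fun j : Fin (m + 1) → κ => ‖∏ k, f k (j k)‖) ∘ (Fin.consEquiv fun _ => κ)) =
          fun p => ‖f 0 p.1 * ∏ k, f k.succ (p.2 k)‖ := by
        rw [← funext_iff.1 e |> funext |> fun h => (congrArg (fun g p => ‖g p‖) h)]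
        rfl
      rw [e']
      exact h4
    · rw [← (Fin.consEquiv fun _ => κ).hasSum_iff]
      change HasSum (fun p : κ × (Fin m → κ) => ∏ k, f k ((Fin.consEquiv fun _ => κ) p k)) _
      rw [e, Fin.prod_univ_succ, ← h2.tsum_eq, h5]
      exact h3.hasSum

variable (H : Type*) [NormedAddCommGroup H] [InnerProductSpace ℂ H] [CompleteSpace H]

/-- The Hilbert space tensor power `H^{⊗m}`, realised through the Hilbert basis `(eᵢ)` of `H` as the
space of square-summable families of coefficients with respect to the orthonormal basis
`e_{j₁} ⊗ ⋯ ⊗ e_{jₘ}`. -/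
abbrev TensorPower (m : ℕ) : Type _ := lp (fun _ : Fin m → basisSet H => ℂ) 2

variable {H} {m : ℕ}

theorem summable_norm_inner_mul (x y : H) :
    Summable fun i => ‖inner ℂ x (basis H i) * inner ℂ (basis H i) y‖ := by
  refine Summable.of_nonneg_of_le (fun _ => norm_nonneg _) (fun i => ?_)
    (((hasSum_norm_sq (basis H) x).summable.add (hasSum_norm_sq (basis H) y).summable).div_const 2)
  rw [norm_mul, norm_inner_symm]
  nlinarith [sq_nonneg (‖inner ℂ (basis H i) x‖ - ‖inner ℂ (basis H i) y‖)]

/-- The elementary tensor `x₁ ⊗ ⋯ ⊗ xₘ`. -/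
def pureTensor (x : Fin m → H) : TensorPower H m :=
  ⟨fun j => ∏ k, inner ℂ (basis H (j k)) (x k), by
    have h := (hasSum_prod m (fun k i => inner ℂ (x k) (basis H i) * inner ℂ (basis H i) (x k))
      fun k => summable_norm_inner_mul (x k) (x k)).1
    refine memℓp_gen ?_
    refine h.congr fun j => ?_
    rw [Finset.prod_mul_distrib, norm_mul, norm_prod, norm_prod]
    simp only [norm_inner_symm (x _)]
    rw [← sq]
    norm_num⟩

theorem inner_pureTensor (x y : Fin m → H) :
    inner ℂ (pureTensor x) (pureTensor y) = ∏ k, inner ℂ (x k) (y k) := by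
  rw [lp.inner_eq_tsum]
  have h := (hasSum_prod m (fun k i => inner ℂ (x k) (basis H i) * inner ℂ (basis H i) (y k))
      fun k => summable_norm_inner_mul (x k) (y k)).2
  simp only [(basis H).tsum_inner_mul_inner] at h
  rw [← h.tsum_eq]
  refine tsum_congr fun j => ?_
  change inner ℂ (∏ k, inner ℂ (basis H (j k)) (x k)) (∏ k, inner ℂ (basis H (j k)) (y k)) = _
  rw [Finset.prod_mul_distrib, RCLike.inner_apply, map_prod, mul_comm]
  simp only [inner_conj_symm]

/-- The vectors `⊗ₖ √Xₖ e_{jₖ}`, over the multi-indices `j`. -/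
def tensorColumn (X : Fin m → DensityOperator H) (j : Fin m → basisSet H) : TensorPower H m :=
  pureTensor fun k => opSqrt (X k).op (basis H (j k))

theorem hasSum_tensorColumn (X : Fin m → DensityOperator H) :
    HasSum (fun j => ‖tensorColumn X j‖ ^ 2) 1 := by
  have h := (hasSum_prod m (fun k i => ((‖opSqrt (X k).op (basis H i)‖ ^ 2 : ℝ) : ℂ))
    fun k => by
      refine (X k).hasSum.summable.congr fun i => ?_
      rw [Complex.norm_real, Real.norm_of_nonneg (by positivity)]).2
  simp only [← Complex.ofReal_tsum, (X _).hasSum.tsum_eq, Complex.ofReal_one,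
    Finset.prod_const_one] at h
  have h2 := Complex.hasSum_re h
  rw [Complex.one_re] at h2
  convert h2 using 1
  ext j
  have e : ((‖tensorColumn X j‖ ^ 2 : ℝ) : ℂ) =
      ∏ k, ((‖opSqrt (X k).op (basis H (j k))‖ ^ 2 : ℝ) : ℂ) := by
    have := inner_pureTensor (fun k => opSqrt (X k).op (basis H (j k)))
      (fun k => opSqrt (X k).op (basis H (j k)))
    simp only [inner_self_eq_norm_sq_to_K] at this
    push_cast
    exact this
  rw [← e, Complex.ofReal_re]

theorem summable_tensorOp (X : Fin m → DensityOperator H) :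
    Summable fun j => rankOne ℂ (tensorColumn X j) (tensorColumn X j) := by
  refine Summable.of_norm ?_
  simpa only [norm_rankOne, ← sq] using (hasSum_tensorColumn X).summable

theorem hasSum_inner_tensorOp (X : Fin m → DensityOperator H) (u v : TensorPower H m) :
    HasSum (fun j => inner ℂ u (tensorColumn X j) * inner ℂ (tensorColumn X j) v)
      (inner ℂ u ((∑' j, rankOne ℂ (tensorColumn X j) (tensorColumn X j)) v)) := by
  have h := ((summable_tensorOp X).hasSum.mapL
    (ContinuousLinearMap.apply ℂ (TensorPower H m) v)).mapL (innerSL ℂ u)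
  simp only [ContinuousLinearMap.apply_apply, innerSL_apply_apply, rankOne_apply,
    inner_smul_right] at h
  simpa only [mul_comm] using h

/-- The product state `X₁ ⊗ ⋯ ⊗ Xₘ`, as the sum of the rank-one operators given by the columns of
`√X₁ ⊗ ⋯ ⊗ √Xₘ`; see `inner_productState` for its matrix coefficients. -/
def productState (X : Fin m → DensityOperator H) : DensityOperator (TensorPower H m) where
  op := ∑' j, rankOne ℂ (tensorColumn X j) (tensorColumn X j)
  isPositive := isPositive_of_inner fun v => by
    have h := hasSum_inner_tensorOp X v v
    have e : ∀ j, inner ℂ v (tensorColumn X j) * inner ℂ (tensorColumn X j) v =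
        ((‖inner ℂ v (tensorColumn X j)‖ ^ 2 : ℝ) : ℂ) := fun j => by
      rw [← inner_conj_symm (tensorColumn X j), Complex.mul_conj']; norm_cast
    simp only [e] at h
    constructor
    · have := Complex.hasSum_re h
      simp only [Complex.ofReal_re] at this
      exact this.nonneg fun j => by positivity
    · have := Complex.hasSum_im h
      simp only [Complex.ofReal_im] at this
      exact this.unique hasSum_zero
  trace_eq_one := by
    have e : ∀ (i : _) (j : _), inner ℂ (basis (TensorPower H m) i) (tensorColumn X j) *
        inner ℂ (tensorColumn X j) (basis (TensorPower H m) i) =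
        ((‖inner ℂ (basis (TensorPower H m) i) (tensorColumn X j)‖ ^ 2 : ℝ) : ℂ) := fun i j => by
      rw [← inner_conj_symm (tensorColumn X j), Complex.mul_conj']; norm_cast
    let f : (Fin m → basisSet H) × basisSet (TensorPower H m) → ℝ := fun p =>
      ‖inner ℂ (basis (TensorPower H m) p.2) (tensorColumn X p.1)‖ ^ 2
    have hrow : ∀ j, HasSum (fun i => f (j, i)) (‖tensorColumn X j‖ ^ 2) := fun j =>
      hasSum_norm_sq (basis (TensorPower H m)) (tensorColumn X j)
    have hf : Summable f := by
      refine (summable_prod_of_nonneg fun p => by positivity).2 ⟨fun j => (hrow j).summable, ?_⟩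
      simpa only [(hrow _).tsum_eq] using (hasSum_tensorColumn X).summable
    have h1 : ∑' j, ∑' i, f (j, i) = 1 := by
      simp only [(hrow _).tsum_eq, (hasSum_tensorColumn X).tsum_eq]
    have h2 : ∑' i, ∑' j, f (j, i) = 1 := by
      rw [← h1]
      exact Summable.tsum_comm (f := fun j i => f (j, i)) hf
    rw [trace, ← Complex.ofReal_one, ← h2, Complex.ofReal_tsum]
    refine tsum_congr fun i => ?_
    rw [← (hasSum_inner_tensorOp X _ _).tsum_eq, Complex.ofReal_tsum]
    exact tsum_congr fun j => e i j

/-- `⟨u₁ ⊗ ⋯ ⊗ uₘ, (X₁ ⊗ ⋯ ⊗ Xₘ) (v₁ ⊗ ⋯ ⊗ vₘ)⟩ = ∏ₖ ⟨uₖ, Xₖ vₖ⟩`. -/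
theorem inner_productState (X : Fin m → DensityOperator H) (u v : Fin m → H) :
    inner ℂ (pureTensor u) ((productState X).op (pureTensor v)) =
      ∏ k, inner ℂ (u k) ((X k).op (v k)) := by
  have h := hasSum_inner_tensorOp X (pureTensor u) (pureTensor v)
  simp only [tensorColumn, inner_pureTensor, ← Finset.prod_mul_distrib] at h
  have h2 := (hasSum_prod m (fun k i => inner ℂ (opSqrt (X k).op (u k)) (basis H i) *
    inner ℂ (basis H i) (opSqrt (X k).op (v k))) fun k => summable_norm_inner_mul _ _).2
  have e : ∀ k, ∑' i, inner ℂ (opSqrt (X k).op (u k)) (basis H i) *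
      inner ℂ (basis H i) (opSqrt (X k).op (v k)) = inner ℂ (u k) ((X k).op (v k)) := fun k => by
    rw [(basis H).tsum_inner_mul_inner, inner_opSqrt, opSqrt_sq (X k).isPositive]
  simp only [e] at h2
  refine h.unique ?_
  simpa only [inner_opSqrt] using h2

end TensorPower

section Measurement

variable {K : Type*} [NormedAddCommGroup K] [InnerProductSpace ℂ K] [CompleteSpace K]

/-- The Born probability `Tr(Z E)` of the effect `E` in the state `Z`. -/
def born (Z : DensityOperator K) (E : K →L[ℂ] K) : ℝ := (trace (Z.op ∘L E)).re

theorem born_nonneg (Z : DensityOperator K) {E : K →L[ℂ] K} (hE : E.IsPositive) :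
    0 ≤ born Z E :=
  (hasSum_born Z hE).1.nonneg fun _ => by positivity

theorem sum_born {Y : Type*} [Fintype Y] (Z : DensityOperator K) (P : POVM K Y) :
    ∑ y, born Z (P.effect y) = 1 := by
  have h := hasSum_sum fun y (_ : y ∈ (Finset.univ : Finset Y)) => (hasSum_born Z (P.isPositive y)).1
  refine h.unique ?_
  convert Z.hasSum using 1
  ext i
  have e : ((∑ y, ‖opSqrt (P.effect y) (opSqrt Z.op (basis K i))‖ ^ 2 : ℝ) : ℂ) =
      ((‖opSqrt Z.op (basis K i)‖ ^ 2 : ℝ) : ℂ) := by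
    push_cast
    have h2 : ∀ y, (‖opSqrt (P.effect y) (opSqrt Z.op (basis K i))‖ : ℂ) ^ 2 =
        inner ℂ (opSqrt Z.op (basis K i)) (P.effect y (opSqrt Z.op (basis K i))) := fun y => by
      rw [inner_eq_norm_opSqrt (P.isPositive y)]; push_cast; rfl
    simp only [h2]
    rw [← inner_sum, ← sum_apply, P.sum_eq_one, one_apply_eq_self, inner_self_eq_norm_sq_to_K]
    rfl
  exact_mod_cast e

/-- The post-measurement state `M Z M / Tr(Z E)`, with `M = √E`, after the outcome of the effect
`E` has been observed. Outcomes of probability zero leave the state unchanged. -/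
def postMeasurement (Z : DensityOperator K) (E : K →L[ℂ] K) (hE : E.IsPositive) :
    DensityOperator K :=
  open Classical in
  if hp : born Z E = 0 then Z else
    { op := ((born Z E)⁻¹ : ℂ) • (opSqrt E ∘L Z.op ∘L opSqrt E)
      isPositive := by
        have h1 := Z.isPositive.conj_adjoint (opSqrt E)
        rw [(opSqrt_isPositive E).isSelfAdjoint.adjoint_eq] at h1
        refine h1.smul_of_nonneg ?_
        rw [← Complex.ofReal_inv]
        exact_mod_cast inv_nonneg.2 (born_nonneg Z hE)
      trace_eq_one := by
        have h := (hasSum_born Z hE).2.2.tsum_eq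
        have e : ∀ i, inner ℂ (basis K i)
            ((((born Z E)⁻¹ : ℂ) • (opSqrt E ∘L Z.op ∘L opSqrt E)) (basis K i)) =
            ((born Z E)⁻¹ : ℂ) * ((‖opSqrt Z.op (opSqrt E (basis K i))‖ ^ 2 : ℝ) : ℂ) := by
          intro i
          rw [smul_apply, inner_smul_right, ContinuousLinearMap.comp_apply,
            ContinuousLinearMap.comp_apply, ← inner_opSqrt, inner_eq_norm_opSqrt Z.isPositive]
        rw [trace]
        simp only [e]
        rw [tsum_mul_left, ← Complex.ofReal_tsum, h]
        exact inv_mul_cancel₀ (Complex.ofReal_ne_zero.2 hp) }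

/-- A measurement with finitely many outcomes, numbered from `0`. -/
abbrev Action (K : Type*) [NormedAddCommGroup K] [InnerProductSpace ℂ K] : Type _ :=
  Σ k : ℕ, POVM K (Fin k)

/-- The law of the outcome of the measurement `A` in the state `Z`. -/
def outcomeLaw (Z : DensityOperator K) (A : Action K) : Measure ℕ :=
  ∑ i, ENNReal.ofReal (born Z (A.2.effect i)) • Measure.dirac (i : ℕ)

instance (Z : DensityOperator K) (A : Action K) : IsProbabilityMeasure (outcomeLaw Z A) := by
  constructor
  rw [outcomeLaw, Measure.finsetSum_apply]
  simp only [Measure.smul_apply, measure_univ, smul_eq_mul, mul_one]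
  rw [← ENNReal.ofReal_sum_of_nonneg fun i _ => born_nonneg Z (A.2.isPositive i), sum_born,
    ENNReal.ofReal_one]

/-- An adaptive measurement strategy: the measurement performed at time `t` is chosen as a
function of the outcomes observed at the times `0, …, t - 1`, and of nothing else. -/
abbrev Strategy (K : Type*) [NormedAddCommGroup K] [InnerProductSpace ℂ K] : Type _ :=
  (t : ℕ) → (Fin t → ℕ) → Action K

/-- The state at time `t`, given the outcomes so far, if the strategy `σ` starts from `Z`. -/
def stateAt (σ : Strategy K) (Z : DensityOperator K) : (t : ℕ) → (Fin t → ℕ) → DensityOperator K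
  | 0, _ => Z
  | t + 1, w =>
    let Zt := stateAt σ Z t (Fin.init w)
    let A := σ t (Fin.init w)
    if h : w (Fin.last t) < A.1 then
      postMeasurement Zt (A.2.effect ⟨w (Fin.last t), h⟩) (A.2.isPositive _)
    else Zt

/-- The conditional law of the outcome at time `t + 1` given the outcomes at times `0, …, t`. -/
def stepKernel (σ : Strategy K) (Z : DensityOperator K) (t : ℕ) :
    Kernel ((i : Finset.Iic t) → (fun _ : ℕ => ℕ) i) ℕ where
  toFun w :=
    let v : Fin (t + 1) → ℕ := fun i => w ⟨i, Finset.mem_Iic.2 (Nat.lt_succ_iff.1 i.2)⟩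
    outcomeLaw (stateAt σ Z (t + 1) v) (σ (t + 1) v)
  measurable' := Measurable.of_discrete

instance (σ : Strategy K) (Z : DensityOperator K) (t : ℕ) : IsMarkovKernel (stepKernel σ Z t) :=
  ⟨fun _ => inferInstanceAs (IsProbabilityMeasure (outcomeLaw _ _))⟩

/-- The law of the infinite sequence of outcomes observed when the strategy `σ` is run on a
register prepared in the state `Z`. -/
def outcomeSequenceLaw (σ : Strategy K) (Z : DensityOperator K) : Measure (ℕ → ℕ) :=
  Kernel.trajMeasure (X := fun _ => ℕ) (outcomeLaw Z (σ 0 Fin.elim0)) (stepKernel σ Z)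

instance (σ : Strategy K) (Z : DensityOperator K) :
    IsProbabilityMeasure (outcomeSequenceLaw σ Z) := by
  rw [outcomeSequenceLaw]; infer_instance

end Measurement

section Learning

variable {H : Type*} [NormedAddCommGroup H] [InnerProductSpace ℂ H] [CompleteSpace H]

/-- States carry the σ-algebra generated by the maps `Z ↦ Tr(Z E)`. -/
instance : MeasurableSpace (DensityOperator H) :=
  ⨆ E : H →L[ℂ] H, MeasurableSpace.comap (fun Z => born Z E) inferInstance

/-- A learning rule for `m` samples with hypotheses in `Hyp`. Using private randomness and the
labels, it measures the register holding the `m` sampled states adaptively, and then outputs a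
hypothesis that depends on the private randomness, the labels and the observed outcomes. -/
structure LearningRule {Y : Type*} [Fintype Y] (Hyp : Set (POVM H Y)) (m : ℕ) where
  Seed : Type
  seedSpace : MeasurableSpace Seed
  seedLaw : Measure Seed
  isProbability : IsProbabilityMeasure seedLaw
  strategy : Seed → (Fin m → Y) → Strategy (TensorPower H m)
  output : Seed → (Fin m → Y) → (ℕ → ℕ) → Hyp

variable {Y : Type*} [Fintype Y]

/-- The risk `E_{(X, Y) ∼ D} ℓ(h[X], Y)`, where `h[X]` is the outcome of measuring `X` by `h`. -/
def risk {𝒳 : Set (DensityOperator H)} [MeasurableSpace Y] (ℓ : Y → Y → ℝ≥0∞)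
    (D : Measure (𝒳 × Y)) (h : POVM H Y) : ℝ≥0∞ :=
  ∫⁻ z, ∑ y, ENNReal.ofReal (born z.1.1 (h.effect y)) * ℓ y z.2 ∂D

/-- The hypotheses whose risk exceeds the infimum over the class by at most `ε`. -/
def nearOptimal {𝒳 : Set (DensityOperator H)} [MeasurableSpace Y] (ℓ : Y → Y → ℝ≥0∞)
    (Hyp : Set (POVM H Y)) (D : Measure (𝒳 × Y)) (ε : ℝ) : Set (POVM H Y) :=
  {h | risk ℓ D h ≤ (⨅ h' ∈ Hyp, risk ℓ D h') + ENNReal.ofReal ε}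

/-- The probability, over the sample `S ∼ D^m`, the private randomness and the measurement
outcomes, that the output of the rule belongs to the set `G`. No measurability is demanded of a
rule: the integrals are the usual ones if the integrands are measurable, and lower integrals
otherwise. -/
def LearningRule.successProbability {𝒳 : Set (DensityOperator H)} [MeasurableSpace Y]
    {Hyp : Set (POVM H Y)} {m : ℕ} (A : LearningRule Hyp m) (D : Measure (𝒳 × Y))
    (G : Set (POVM H Y)) : ℝ≥0∞ :=
  letI := A.seedSpace
  ∫⁻ S, ∫⁻ s, ∫⁻ ω, {ω' | (A.output s (fun k => (S k).2) ω' : POVM H Y) ∈ G}.indicator 1 ω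
      ∂outcomeSequenceLaw (A.strategy s fun k => (S k).2) (productState fun k => (S k).1.1)
    ∂A.seedLaw ∂Measure.pi fun _ : Fin m => D

/-- `(ε, δ)`-PAC learnability of the class `Hyp` on the domain `𝒳` for the loss `ℓ`: for some sample
size, some rule is near-optimal with probability at least `1 - δ` for every distribution `D`. -/
def IsPACLearnableWith [MeasurableSpace Y] (ℓ : Y → Y → ℝ≥0∞) (𝒳 : Set (DensityOperator H))
    (Hyp : Set (POVM H Y)) (ε δ : ℝ) : Prop :=
  ∃ (m : ℕ) (A : LearningRule Hyp m), ∀ D : Measure (𝒳 × Y), IsProbabilityMeasure D →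
    ENNReal.ofReal (1 - δ) ≤ A.successProbability D (nearOptimal ℓ Hyp D ε)

/-- PAC learnability: `(ε, δ)`-PAC learnability for all `ε > 0` and `δ > 0`. -/
def IsPACLearnable [MeasurableSpace Y] (ℓ : Y → Y → ℝ≥0∞) (𝒳 : Set (DensityOperator H))
    (Hyp : Set (POVM H Y)) : Prop :=
  ∀ ε > 0, ∀ δ > 0, IsPACLearnableWith ℓ 𝒳 Hyp ε δ

/-- The misclassification loss. -/
def misclassificationLoss (y y' : Fin 2) : ℝ≥0∞ := if y = y' then 0 else 1

end Learning

section FatShattering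

/-- The family `x` is `γ`-fat-shattered by `F` with witness numbers `r`. -/
def FatShattersWith {X ι : Type*} (F : Set (X → ℝ)) (γ : ℝ) (x : ι → X) (r : ι → ℝ) : Prop :=
  ∀ b : ι → Fin 2, ∃ f ∈ F, ∀ i,
    (b i = 0 → f (x i) ≤ r i - γ) ∧ (b i = 1 → r i + γ ≤ f (x i))

/-- The family `x` is `γ`-fat-shattered by `F`. -/
def FatShatters {X ι : Type*} (F : Set (X → ℝ)) (γ : ℝ) (x : ι → X) : Prop :=
  ∃ r : ι → ℝ, FatShattersWith F γ x r

/-- The `γ`-fat-shattering dimension, equal to `⊤` if arbitrarily long datasets are shattered. -/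
def fatShatteringDim {X : Type*} (F : Set (X → ℝ)) (γ : ℝ) : ℕ∞ :=
  ⨆ (m : ℕ) (_ : ∃ x : Fin m → X, FatShatters F γ x), (m : ℕ∞)

variable {H : Type*} [NormedAddCommGroup H] [InnerProductSpace ℂ H] [CompleteSpace H]

/-- The functions on `𝒳` induced by a class of two-outcome POVMs: a distribution on `{0, 1}` is
identified with the probability that it gives to `1`. -/
def inducedClass (𝒳 : Set (DensityOperator H)) (Hyp : Set (POVM H (Fin 2))) : Set (𝒳 → ℝ) :=
  {f | ∃ h ∈ Hyp, f = fun x => born x.1 (h.effect 1)}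

end FatShattering

section Example

variable {H : Type*} [NormedAddCommGroup H] [InnerProductSpace ℂ H] [CompleteSpace H]

/-- The weights `β_j^{1 - b_j} (1 - β_j)^{b_j}`. -/
def weight (β : ℕ → ℝ) (b : ℕ → Fin 2) (j : ℕ) : ℝ :=
  β j ^ (1 - (b j : ℕ)) * (1 - β j) ^ (b j : ℕ)

theorem mem_Icc_of_mem_Ioo {γ : ℝ} (hγ : 0 < γ) {β : ℕ → ℝ}
    (hβ : ∀ j, β j ∈ Set.Ioo (1 / 2 + γ) 1) (j : ℕ) : β j ∈ Set.Icc (0 : ℝ) 1 :=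
  ⟨by linarith [(hβ j).1], (hβ j).2.le⟩

theorem weight_mem {β : ℕ → ℝ} (hβ : ∀ j, β j ∈ Set.Icc (0 : ℝ) 1) (b : ℕ → Fin 2) (j : ℕ) :
    weight β b j ∈ Set.Icc (0 : ℝ) 1 := by
  obtain ⟨h0, h1⟩ := hβ j
  rw [weight]
  generalize b j = c
  fin_cases c <;> simp [h0, h1]

/-- The POVM with `Π₀ = ∑ⱼ β_j^{1 - b_j} (1 - β_j)^{b_j} |ρⱼ⟩⟨ρⱼ|`. -/
def bitPOVM {ρ : ℕ → H} (hρ : Orthonormal ℂ ρ) {β : ℕ → ℝ}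
    (hβ : ∀ j, β j ∈ Set.Icc (0 : ℝ) 1) (b : ℕ → Fin 2) : POVM H (Fin 2) :=
  diagonalPOVM hρ (weight β b) (weight_mem hβ b)

/-- The class of all the POVMs `bitPOVM hρ hβ b`. -/
def bitClass {ρ : ℕ → H} (hρ : Orthonormal ℂ ρ) {β : ℕ → ℝ}
    (hβ : ∀ j, β j ∈ Set.Icc (0 : ℝ) 1) : Set (POVM H (Fin 2)) :=
  Set.range (bitPOVM hρ hβ)

end Example
end
end POVMLearning

open POVMLearning

/-!
The positive claims are computations with the Born rule: `Tr(|v⟩⟨v| E) = ⟨v, E v⟩`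
(`born_pureState`), and `ρⱼ` is an eigenvector of `Π₀` for the `j`-th weight, so measuring `xⱼ` by
`Π^{(b)}` gives `bⱼ` with probability `βⱼ` and the other outcome with probability `1 - βⱼ`
(`born_bitPOVM`).

Non-learnability is a no-free-lunch argument, and the quantum nature of the rule plays no role in
it: whatever the rule measures, the law of its outcomes is determined by the sampled states and
their labels. Fix a sample size `m`, put `n = 2m + 1`, and for `b ∈ {0,1}ⁿ` let `D_b` be the uniform
distribution on the pairs `(xⱼ, bⱼ)`, `j < n` (`labelledUniform`). Given the sampled indices `J`, the
labellings `b` and `flipOff J b`, which differ exactly at the at least `m + 1` indices that were not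
sampled, produce the same sample. A hypothesis `Π^{(b')}` exceeds the optimal risk for `D_b` by more
than `2γ/n` for each `j` with `b'ⱼ ≠ bⱼ` (`card_ne_le_of_mem_nearOptimal`), and `b'` disagrees with one
of the two labellings at each unsampled index; hence no hypothesis is `γ/2`-optimal for both
(`disjoint_nearOptimal_flipOff`). As `flipOff J` is an involution, the success probability averaged
over all `b` is at most `1/2` (`sum_successProbability_le`), so it is below `3/4` for some `b`.
-/

namespace POVMLearning

variable {H : Type*} [NormedAddCommGroup H] [InnerProductSpace ℂ H] [CompleteSpace H]

/-! ### Measuring the basis states -/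

theorem born_pureState (v : H) (hv : ‖v‖ = 1) (E : H →L[ℂ] H) :
    born (pureState v hv) E = (inner ℂ v (E v)).re := by
  have h := (basis H).tsum_inner_mul_inner (ContinuousLinearMap.adjoint E v) v
  rw [ContinuousLinearMap.adjoint_inner_left] at h
  rw [born, trace, ← h]
  refine congrArg Complex.re (tsum_congr fun i => ?_)
  rw [ContinuousLinearMap.comp_apply, ContinuousLinearMap.adjoint_inner_left]
  change inner ℂ (basis H i) (rankOne ℂ v v (E (basis H i))) = _
  rw [rankOne_apply, inner_smul_right]

theorem diagonalOp_apply_self {ρ : ℕ → H} (hρ : Orthonormal ℂ ρ) {c : ℕ → ℝ}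
    (hc : ∀ j, c j ∈ Set.Icc (0 : ℝ) 1) (j : ℕ) :
    diagonalOp hρ c hc (ρ j) = (c j : ℂ) • ρ j := by
  refine (hasSum_diagonalOp hρ hc (ρ j)).unique ?_
  convert hasSum_single j (fun i hi => ?_) using 1
  · rw [rankOne_apply, inner_self_eq_norm_sq_to_K, hρ.1 j]
    simp
  · rw [rankOne_apply, hρ.2 hi]
    simp

theorem born_bitPOVM {ρ : ℕ → H} (hρ : Orthonormal ℂ ρ) {β : ℕ → ℝ}
    (hβ : ∀ j, β j ∈ Set.Icc (0 : ℝ) 1) (b : ℕ → Fin 2) (j : ℕ) (y : Fin 2) :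
    born (pureState (ρ j) (hρ.1 j)) ((bitPOVM hρ hβ b).effect y) =
      if b j = y then β j else 1 - β j := by
  have h0 : (inner ℂ (ρ j) (diagonalOp hρ (weight β b) (weight_mem hβ b) (ρ j))).re =
      weight β b j := by
    rw [diagonalOp_apply_self, inner_smul_right, inner_self_eq_norm_sq_to_K, hρ.1 j]
    simp
  have h1 : (inner ℂ (ρ j) ((1 - diagonalOp hρ (weight β b) (weight_mem hβ b)) (ρ j))).re =
      1 - weight β b j := by
    rw [sub_apply, one_apply_eq_self, inner_sub_right, Complex.sub_re, h0,
      inner_self_eq_norm_sq_to_K, hρ.1 j]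
    simp
  rw [born_pureState]
  have hw : weight β b j = if b j = 0 then β j else 1 - β j := by
    rw [weight]
    generalize b j = c
    fin_cases c <;> simp
  fin_cases y
  · exact h0.trans hw
  · refine h1.trans ?_
    rw [hw]
    generalize b j = c
    fin_cases c <;> simp

theorem pureState_injective {ρ : ℕ → H} (hρ : Orthonormal ℂ ρ) :
    Function.Injective fun j => pureState (ρ j) (hρ.1 j) := by
  intro i j hij
  by_contra hne
  have h : rankOne ℂ (ρ i) (ρ i) = rankOne ℂ (ρ j) (ρ j) := congrArg DensityOperator.op hij
  have h2 := congrArg (fun T : H →L[ℂ] H => T (ρ i)) h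
  simp only [rankOne_apply, inner_self_eq_norm_sq_to_K, hρ.1 i, hρ.2 (Ne.symm hne)] at h2
  exact hρ.ne_zero i (by simpa using h2)

/-! ### Fat-shattering -/

theorem FatShattersWith.comp_injective {X ι κ : Type*} {F : Set (X → ℝ)} {γ : ℝ} {x : ι → X}
    {r : ι → ℝ} (h : FatShattersWith F γ x r) {g : κ → ι} (hg : Function.Injective g) :
    FatShattersWith F γ (x ∘ g) (r ∘ g) := by
  intro b
  obtain ⟨f, hf, hfx⟩ := h (Function.extend g b 0)
  refine ⟨f, hf, fun i => ?_⟩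
  simpa only [hg.extend_apply, Function.comp_apply] using hfx (g i)

theorem fatShatteringDim_eq_top {X : Type*} {F : Set (X → ℝ)} {γ : ℝ} {x : ℕ → X} {r : ℕ → ℝ}
    (h : FatShattersWith F γ x r) : fatShatteringDim F γ = ⊤ := by
  rw [ENat.eq_top_iff_forall_ge]
  intro m
  exact le_iSup₂_of_le (f := fun (m : ℕ) (_ : ∃ x : Fin m → X, FatShatters F γ x) => (m : ℕ∞)) m
    ⟨_, _, h.comp_injective Fin.val_injective⟩ le_rfl

/-! ### No free lunch -/

/-- The labelling that agrees with `b` at the indices `J 0, …, J (m - 1)` and differs from it at all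
the others. -/
def flipOff {m n : ℕ} (J : Fin m → Fin n) (b : Fin n → Fin 2) (j : Fin n) : Fin 2 :=
  open Classical in if j ∈ Set.range J then b j else (b j).rev

theorem flipOff_involutive {m n : ℕ} (J : Fin m → Fin n) : Function.Involutive (flipOff J) := by
  intro b
  ext j
  by_cases hj : j ∈ Set.range J <;> simp only [flipOff, hj, if_true, if_false, Fin.rev_rev]

theorem flipOff_apply_sample {m n : ℕ} (J : Fin m → Fin n) (b : Fin n → Fin 2) (k : Fin m) :
    flipOff J b (J k) = b (J k) :=
  if_pos ⟨k, rfl⟩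

/-- At each of the unsampled indices, any labelling `c` differs from `b` or from `flipOff J b`. -/
theorem le_card_ne_add_card_ne_flipOff {m n : ℕ} (J : Fin m → Fin n) (b c : Fin n → Fin 2) :
    n ≤ m + ((Finset.univ.filter fun j => c j ≠ b j).card +
      (Finset.univ.filter fun j => c j ≠ flipOff J b j).card) := by
  have hcov : (Finset.univ : Finset (Fin n)) ⊆ Finset.univ.image J ∪
      ((Finset.univ.filter fun j => c j ≠ b j) ∪
        (Finset.univ.filter fun j => c j ≠ flipOff J b j)) := by
    intro j _
    simp only [Finset.mem_union, Finset.mem_image, Finset.mem_filter, Finset.mem_univ, true_and]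
    by_cases hj : j ∈ Set.range J
    · exact Or.inl hj
    · right
      have e : flipOff J b j = (b j).rev := if_neg hj
      rw [e]
      generalize b j = p, c j = q
      revert p q
      decide
  have h1 := Finset.card_le_card hcov
  have h2 : (Finset.univ.image J).card ≤ m := Finset.card_image_le.trans_eq (by simp)
  rw [Finset.card_univ, Fintype.card_fin] at h1
  have h3 := Finset.card_union_le (Finset.univ.image J)
    ((Finset.univ.filter fun j => c j ≠ b j) ∪
        (Finset.univ.filter fun j => c j ≠ flipOff J b j))
  have h4 := Finset.card_union_le (Finset.univ.filter fun j => c j ≠ b j)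
        (Finset.univ.filter fun j => c j ≠ flipOff J b j)
  omega

/-- The uniform distribution on `Fin n`. -/
noncomputable def uniformLaw (n : ℕ) : Measure (Fin n) := (n : ℝ≥0∞)⁻¹ • Measure.count

instance (n : ℕ) [NeZero n] : IsProbabilityMeasure (uniformLaw n) := by
  constructor
  rw [uniformLaw, Measure.smul_apply, Measure.count_univ, smul_eq_mul]
  simp only [ENat.card_eq_coe_fintype_card, Fintype.card_fin]
  exact ENNReal.inv_mul_cancel (by simp [NeZero.ne n]) (by simp)

/-- The law of `(x j, b j)` for a uniformly distributed index `j`. -/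
noncomputable def labelledUniform {𝒳 : Set (DensityOperator H)} {n : ℕ} (x : Fin n → 𝒳)
    (b : Fin n → Fin 2) : Measure (𝒳 × Fin 2) :=
  (uniformLaw n).map fun j => (x j, b j)

instance {𝒳 : Set (DensityOperator H)} {n : ℕ} [NeZero n] (x : Fin n → 𝒳) (b : Fin n → Fin 2) :
    IsProbabilityMeasure (labelledUniform x b) :=
  Measure.isProbabilityMeasure_map Measurable.of_discrete.aemeasurable

/-- If no hypothesis belongs both to `G b` and to `G (flipOff J b)`, then the success probability,
averaged over the labellings `b`, is at most `1/2`. -/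
theorem sum_successProbability_le {𝒳 : Set (DensityOperator H)} {Hyp : Set (POVM H (Fin 2))}
    {m n : ℕ} [NeZero n] (A : LearningRule Hyp m) (x : Fin n → 𝒳)
    (G : (Fin n → Fin 2) → Set (POVM H (Fin 2)))
    (hG : ∀ (J : Fin m → Fin n) b, ∀ h ∈ Hyp, h ∈ G b → h ∉ G (flipOff J b)) :
    2 * ∑ b, A.successProbability (labelledUniform x b) (G b) ≤ 2 ^ n := by
  let := A.seedSpace
  have := A.isProbability
  let F : (Fin m → Fin 2) → (Fin m → 𝒳) → Set (POVM H (Fin 2)) → ℝ≥0∞ := fun y X G =>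
    ∫⁻ s, ∫⁻ ω, {ω' | (A.output s y ω' : POVM H (Fin 2)) ∈ G}.indicator 1 ω
      ∂outcomeSequenceLaw (A.strategy s y) (productState fun k => (X k).1) ∂A.seedLaw
  -- The integrand need not be measurable, but a lower integral still decreases under pullback.
  have hpull : ∀ b, A.successProbability (labelledUniform x b) (G b) ≤
      ∫⁻ J, F (fun k => b (J k)) (fun k => x (J k)) (G b)
        ∂Measure.pi fun _ : Fin m => uniformLaw n := by
    intro b
    have hpi : (Measure.pi fun _ : Fin m => labelledUniform x b) =
        (Measure.pi fun _ : Fin m => uniformLaw n).map fun J k => (x (J k), b (J k)) := by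
      have : ∀ _ : Fin m, SigmaFinite ((uniformLaw n).map fun j => (x j, b j)) := fun _ =>
        inferInstanceAs (SigmaFinite (labelledUniform x b))
      exact (Measure.pi_map_pi (μ := fun _ : Fin m => uniformLaw n)
        (f := fun _ j => (x j, b j)) fun _ => Measurable.of_discrete.aemeasurable).symm
    rw [LearningRule.successProbability, hpi]
    exact lintegral_map_le _ _
  -- The labellings `b` and `flipOff J b` give the same sample, hence the same law of the output.
  have hpair : ∀ (J : Fin m → Fin n) b, F (fun k => b (J k)) (fun k => x (J k)) (G b) +
      F (fun k => flipOff J b (J k)) (fun k => x (J k)) (G (flipOff J b)) ≤ 1 := by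
    intro J b
    simp only [flipOff_apply_sample]
    refine (le_lintegral_add _ _).trans ?_
    refine (lintegral_mono fun s => ?_).trans_eq (lintegral_one.trans measure_univ)
    refine (le_lintegral_add _ _).trans ?_
    refine (lintegral_mono fun ω => ?_).trans_eq (lintegral_one.trans measure_univ)
    have h := hG J b _ (A.output s (fun k => b (J k)) ω).2
    by_cases h1 : (A.output s (fun k => b (J k)) ω : POVM H (Fin 2)) ∈ G b
    · simp [Set.indicator, h1, h h1]
    · simp only [Set.indicator, Set.mem_ofPred_eq, h1, if_false, zero_add]
      split_ifs <;> simp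
  have hsum : ∀ J : Fin m → Fin n,
      2 * ∑ b, F (fun k => b (J k)) (fun k => x (J k)) (G b) ≤ 2 ^ n := by
    intro J
    have e := (flipOff_involutive J).toPerm.sum_comp Finset.univ
      (fun b => F (fun k => b (J k)) (fun k => x (J k)) (G b)) (by simp)
    simp only [Function.Involutive.coe_toPerm] at e
    calc 2 * ∑ b, F (fun k => b (J k)) (fun k => x (J k)) (G b)
        = ∑ b, (F (fun k => b (J k)) (fun k => x (J k)) (G b) +
            F (fun k => flipOff J b (J k)) (fun k => x (J k)) (G (flipOff J b))) := by
          rw [Finset.sum_add_distrib, e, two_mul]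
      _ ≤ ∑ _b : Fin n → Fin 2, 1 := Finset.sum_le_sum fun b _ => hpair J b
      _ = 2 ^ n := by simp
  calc 2 * ∑ b, A.successProbability (labelledUniform x b) (G b)
      ≤ 2 * ∑ b, ∫⁻ J, F (fun k => b (J k)) (fun k => x (J k)) (G b)
          ∂Measure.pi fun _ : Fin m => uniformLaw n := by
        gcongr with b
        exact hpull b
    _ = ∫⁻ J, 2 * ∑ b, F (fun k => b (J k)) (fun k => x (J k)) (G b)
          ∂Measure.pi fun _ : Fin m => uniformLaw n := by
        rw [lintegral_const_mul _ Measurable.of_discrete,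
          lintegral_finsetSum _ fun _ _ => Measurable.of_discrete]
    _ ≤ ∫⁻ _J, 2 ^ n ∂Measure.pi fun _ : Fin m => uniformLaw n := lintegral_mono hsum
    _ = 2 ^ n := by rw [lintegral_const, measure_univ, mul_one]

/-! ### Excess risk in the class -/

theorem measurable_born (E : H →L[ℂ] H) : Measurable fun Z : DensityOperator H => born Z E :=
  Measurable.of_comap_le (le_iSup (fun E : H →L[ℂ] H =>
    MeasurableSpace.comap (fun Z => born Z E) inferInstance) E)

theorem risk_labelledUniform {𝒳 : Set (DensityOperator H)} {n : ℕ} (x : Fin n → 𝒳)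
    (b : Fin n → Fin 2) (h : POVM H (Fin 2)) :
    risk misclassificationLoss (labelledUniform x b) h =
      (n : ℝ≥0∞)⁻¹ * ENNReal.ofReal (∑ j, born (x j).1 (h.effect (b j).rev)) := by
  have hm : Measurable fun z : 𝒳 × Fin 2 => ∑ y, ENNReal.ofReal (born z.1.1 (h.effect y)) *
      misclassificationLoss y z.2 := by
    refine Finset.measurable_sum _ fun y _ => Measurable.mul ?_ ?_
    · exact ((measurable_born _).comp (measurable_subtype_coe.comp measurable_fst)).ennreal_ofReal
    · exact (Measurable.of_discrete (f := misclassificationLoss y)).comp measurable_snd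
  rw [risk, labelledUniform, lintegral_map hm Measurable.of_discrete, uniformLaw,
    lintegral_smul_measure, smul_eq_mul, lintegral_count, tsum_fintype,
    ENNReal.ofReal_sum_of_nonneg fun j _ => born_nonneg _ (h.isPositive _)]
  congr 1
  refine Finset.sum_congr rfl fun j _ => ?_
  rw [Fin.sum_univ_two]
  generalize b j = c
  fin_cases c <;> simp [misclassificationLoss, Fin.rev]

/-- Each disagreement of `b'` with the labelling `b` costs `2 βⱼ - 1 ≥ 2γ` in the unnormalised
risk. -/
theorem card_ne_le_of_mem_nearOptimal {ρ : ℕ → H} (hρ : Orthonormal ℂ ρ) {γ : ℝ} (hγ : 0 < γ)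
    {β : ℕ → ℝ} (hβ : ∀ j, β j ∈ Set.Ioo (1 / 2 + γ) 1) {𝒳 : Set (DensityOperator H)} {n : ℕ}
    [NeZero n] (x : Fin n → 𝒳)
    (hx : ∀ j, (x j : DensityOperator H) = pureState (ρ j) (hρ.1 j)) (b : Fin n → Fin 2)
    (b' : ℕ → Fin 2) {ε : ℝ} (hε : 0 ≤ ε)
    (h : bitPOVM hρ (mem_Icc_of_mem_Ioo hγ hβ) b' ∈ nearOptimal misclassificationLoss
      (bitClass hρ (mem_Icc_of_mem_Ioo hγ hβ)) (labelledUniform x b) ε) :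
    2 * γ * (Finset.univ.filter fun j : Fin n => b' j ≠ b j).card ≤ n * ε := by
  -- The optimal hypothesis: any extension of `b` to an infinite labelling.
  let c : ℕ → Fin 2 := Function.extend Fin.val b 0
  have hc : ∀ j : Fin n, c j = b j := fun j => Fin.val_injective.extend_apply b 0 j
  rw [nearOptimal, Set.mem_ofPred_eq] at h
  have hopt := h.trans (add_le_add_left (iInf₂_le _ (Set.mem_range_self c)) (ENNReal.ofReal ε))
  simp only [risk_labelledUniform, hx, born_bitPOVM, hc] at hopt
  have e1 : ∀ a d : Fin 2, (a = d.rev) = (a ≠ d) := by decide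
  simp only [e1] at hopt
  simp only [ne_eq, not_true_eq_false, if_false] at hopt
  have hn : (n : ℝ≥0∞) ≠ 0 := by simp [NeZero.ne n]
  have hn' : (n : ℝ≥0∞) ≠ ∞ := by simp
  have hmul := mul_le_mul_right hopt (n : ℝ≥0∞)
  have h0 : 0 ≤ ∑ j : Fin n, (1 - β j) :=
    Finset.sum_nonneg fun j _ => by linarith [(hβ j).2]
  rw [mul_add, ← mul_assoc, ← mul_assoc, ENNReal.mul_inv_cancel hn hn', one_mul, one_mul,
    ← ENNReal.ofReal_natCast n, ← ENNReal.ofReal_mul (by positivity),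
    ← ENNReal.ofReal_add h0 (by positivity),
    ENNReal.ofReal_le_ofReal_iff (by positivity)] at hmul
  have hcost : ∑ j : Fin n, ((1 - β j) + if b' j ≠ b j then 2 * γ else 0) ≤
      ∑ j : Fin n, if ¬ b' j = b j then β j else 1 - β j := by
    refine Finset.sum_le_sum fun j _ => ?_
    by_cases hj : b' j = b j
    · simp [hj]
    · simp only [ne_eq, hj, not_false_eq_true, if_true]
      linarith [(hβ j).1]
  rw [Finset.sum_add_distrib, ← Finset.sum_filter, Finset.sum_const, nsmul_eq_mul] at hcost
  linarith

theorem disjoint_nearOptimal_flipOff {ρ : ℕ → H} (hρ : Orthonormal ℂ ρ) {γ : ℝ} (hγ : 0 < γ)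
    {β : ℕ → ℝ} (hβ : ∀ j, β j ∈ Set.Ioo (1 / 2 + γ) 1) {𝒳 : Set (DensityOperator H)} {m : ℕ}
    (x : Fin (2 * m + 1) → 𝒳)
    (hx : ∀ j, (x j : DensityOperator H) = pureState (ρ j) (hρ.1 j))
    (J : Fin m → Fin (2 * m + 1)) (b : Fin (2 * m + 1) → Fin 2) (h : POVM H (Fin 2))
    (hmem : h ∈ bitClass hρ (mem_Icc_of_mem_Ioo hγ hβ))
    (h1 : h ∈ nearOptimal misclassificationLoss (bitClass hρ (mem_Icc_of_mem_Ioo hγ hβ))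
      (labelledUniform x b) (γ / 2)) :
    h ∉ nearOptimal misclassificationLoss (bitClass hρ (mem_Icc_of_mem_Ioo hγ hβ))
      (labelledUniform x (flipOff J b)) (γ / 2) := by
  intro h2
  obtain ⟨b', rfl⟩ := hmem
  have k1 := card_ne_le_of_mem_nearOptimal hρ hγ hβ x hx b b' (by positivity) h1
  have k2 := card_ne_le_of_mem_nearOptimal hρ hγ hβ x hx (flipOff J b) b' (by positivity) h2
  have k3 := le_card_ne_add_card_ne_flipOff J b fun j => b' j
  have k4 : ((2 * m + 1 : ℕ) : ℝ) ≤ m + ((Finset.univ.filter fun j : Fin (2 * m + 1) =>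
      b' j ≠ b j).card + (Finset.univ.filter fun j : Fin (2 * m + 1) =>
        b' j ≠ flipOff J b j).card) := by exact_mod_cast k3
  push_cast at k1 k2 k4
  -- Twice the `m + 1` disagreements exceed `2m + 1`.
  nlinarith [mul_le_mul_of_nonneg_left k4 hγ.le]

theorem not_isPACLearnable_bitClass {ρ : ℕ → H} (hρ : Orthonormal ℂ ρ) {γ : ℝ} (hγ : 0 < γ)
    {β : ℕ → ℝ} (hβ : ∀ j, β j ∈ Set.Ioo (1 / 2 + γ) 1) {𝒳 : Set (DensityOperator H)} (x : ℕ → 𝒳)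
    (hx : ∀ j, (x j : DensityOperator H) = pureState (ρ j) (hρ.1 j)) :
    ¬ IsPACLearnable misclassificationLoss 𝒳 (bitClass hρ (mem_Icc_of_mem_Ioo hγ hβ)) := by
  intro hPAC
  obtain ⟨m, A, hA⟩ := hPAC (γ / 2) (by positivity) (1 / 4) (by norm_num)
  have hle := sum_successProbability_le A (fun j : Fin (2 * m + 1) => x j)
    (fun b => nearOptimal misclassificationLoss (bitClass hρ (mem_Icc_of_mem_Ioo hγ hβ))
      (labelledUniform (fun j : Fin (2 * m + 1) => x j) b) (γ / 2))
    fun J b h => disjoint_nearOptimal_flipOff hρ hγ hβ _ (fun j => hx j) J b h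
  have hge : ∑ _b : Fin (2 * m + 1) → Fin 2, ENNReal.ofReal (1 - 1 / 4) ≤ _ :=
    Finset.sum_le_sum fun b _ =>
      hA (labelledUniform (fun j : Fin (2 * m + 1) => x j) b) inferInstance
  have h2 := (mul_le_mul_right hge 2).trans hle
  rw [Finset.sum_const, nsmul_eq_mul, Finset.card_univ, Fintype.card_fun, Fintype.card_fin,
    Fintype.card_fin] at h2
  have h3 : ENNReal.ofReal (2 * (2 ^ (2 * m + 1) * (1 - 1 / 4))) ≤
      ENNReal.ofReal (2 ^ (2 * m + 1)) := by
    rw [ENNReal.ofReal_mul (by positivity), ENNReal.ofReal_mul (by positivity),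
      ENNReal.ofReal_pow (by positivity)]
    simpa using h2
  rw [ENNReal.ofReal_le_ofReal_iff (by positivity)] at h3
  have h4 : (0 : ℝ) < 2 ^ (2 * m + 1) := by positivity
  linarith

end POVMLearning

theorem mainTheorem9 {H : Type*} [NormedAddCommGroup H] [InnerProductSpace ℂ H] [CompleteSpace H]
    (ρ : ℕ → H) (hρ : Orthonormal ℂ ρ) (γ : ℝ) (hγ : 0 < γ) (β : ℕ → ℝ)
    (hβ : ∀ j, β j ∈ Set.Ioo (1 / 2 + γ) 1)
    (𝒳 : Set (DensityOperator H)) (x : ℕ → 𝒳)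
    (hx : ∀ j, (x j : DensityOperator H) = pureState (ρ j) (hρ.1 j)) :
    (∀ (b : ℕ → Fin 2) (j : ℕ),
      born (x j : DensityOperator H)
        ((bitPOVM hρ (mem_Icc_of_mem_Ioo hγ hβ) b).effect (b j)) = β j) ∧
    Function.Injective x ∧
    FatShattersWith (inducedClass 𝒳 (bitClass hρ (mem_Icc_of_mem_Ioo hγ hβ))) γ x
      (fun _ => 1 / 2) ∧
    fatShatteringDim (inducedClass 𝒳 (bitClass hρ (mem_Icc_of_mem_Ioo hγ hβ))) γ = ⊤ ∧
    ¬ IsPACLearnable misclassificationLoss 𝒳 (bitClass hρ (mem_Icc_of_mem_Ioo hγ hβ)) := by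
  have hfat : FatShattersWith (inducedClass 𝒳 (bitClass hρ (mem_Icc_of_mem_Ioo hγ hβ))) γ x
      (fun _ => 1 / 2) := by
    intro b
    refine ⟨_, ⟨_, Set.mem_range_self b, rfl⟩, fun j => ?_⟩
    rw [hx, born_bitPOVM]
    constructor
    · intro hj
      rw [hj, if_neg (by decide)]
      linarith [(hβ j).1]
    · intro hj
      rw [if_pos hj]
      exact (hβ j).1.le
  refine ⟨fun b j => ?_, fun i j hij => ?_, hfat, fatShatteringDim_eq_top hfat,
    not_isPACLearnable_bitClass hρ hγ hβ x hx⟩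
  · rw [hx, born_bitPOVM, if_pos rfl]
  · apply pureState_injective hρ
    simp only [← hx, hij]
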